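/- Let $k$ be an algebraically closed field of characteristic $2$. Let $\mathfrak{M}$ be a finite group of order $3\cdot 2^n$ with $n\ge 3$. Assume that $\mathfrak{M}$ has $2$-length $2$ and that $O_{2'}(\mathfrak{M})=1$. Let $P$ be a Sylow $2$-subgroup of $\mathfrak{M}$ and $\mathcal{F}=\mathcal{F}_P(\mathfrak{M})$. Let $G=\mathrm{Park}(\mathcal{F},\mathfrak{M})$ be Park's group, that is, the group of all bijections $f:\mathfrak{M}\to\mathfrak{M}$ with $f(mu)=f(m)u$ for all $m\in\mathfrak{M}$ and $u\in P$, and let $\iota:P\to G$, $\iota(u)=(m\mapsto um)$, be Park's embedding. Then $G\cong P\wr S_3$, and the Scott $kG$-module $\mathrm{Sc}(G,\iota P)$ exists and is Brauer indecomposable. Here $\mathrm{Sc}(G,\iota P)$ denotes any indecomposable direct summand of the induced module $\mathrm{Ind}_{\iota P}^G(k)$ of the trivial module that has the trivial $kG$-module in its socle. A $kG$-module $M$ is Brauer indecomposable if, for every $2$-subgroup $Q$ of $G$, the Brauer quotient $M(Q)=M^Q/\sum_{R<Q}\mathrm{Tr}_R^Q(M^R)$ is zero or indecomposable as a $k(Q\,C_G(Q))$-module.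 -/

import Mathlib

/-! ### Cores and `p`-length of a finite group -/

section PLength

variable (p : ℕ) (G : Type*) [Group G]

/-- `O_p(G)`: the subgroup generated by all normal `p`-subgroups of `G`. -/
def pCore : Subgroup G :=
  sSup {K : Subgroup G | K.Normal ∧ IsPGroup p K}

/-- `O_{p'}(G)`: the subgroup generated by all normal subgroups of `G` of order prime to `p`. -/
def pPrimeCore : Subgroup G :=
  sSup {K : Subgroup G | K.Normal ∧ (Nat.card K).Coprime p}

instance pCore_normal : (pCore p G).Normal :=
  Subgroup.sSup_normal _ fun _ h => h.1

instance pPrimeCore_normal : (pPrimeCore p G).Normal :=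
  Subgroup.sSup_normal _ fun _ h => h.1

variable {G}

/-- For `N` normal in `G`, the full preimage in `G` of `O_p(G/N)`. -/
def pCoreOver (N : {N : Subgroup G // N.Normal}) : {N : Subgroup G // N.Normal} :=
  haveI := N.2
  ⟨(pCore p (G ⧸ N.1)).comap (QuotientGroup.mk' N.1), inferInstance⟩

/-- For `N` normal in `G`, the full preimage in `G` of `O_{p'}(G/N)`. -/
def pPrimeCoreOver (N : {N : Subgroup G // N.Normal}) : {N : Subgroup G // N.Normal} :=
  haveI := N.2
  ⟨(pPrimeCore p (G ⧸ N.1)).comap (QuotientGroup.mk' N.1), inferInstance⟩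

variable (G)

/-- The terms of the upper `p'p`-series of `G` that end with a `p'`-step:
`O_{p'}(G)`, `O_{p',p,p'}(G)`, `O_{p',p,p',p,p'}(G)`, … -/
def upperPSeries : ℕ → {N : Subgroup G // N.Normal}
  | 0 => ⟨pPrimeCore p G, inferInstance⟩
  | l + 1 => pPrimeCoreOver p (pCoreOver p (upperPSeries l))

/-- `G` is `p`-solvable of `p`-length `l`: the upper `p'p`-series reaches `G`, and the number
of its `p`-steps needed for this is exactly `l`. -/
def HasPLength (l : ℕ) : Prop :=
  IsLeast {j : ℕ | (upperPSeries p G j).1 = ⊤} l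

end PLength

/-! ### Park's group and Park's embedding -/

section Park

variable {M : Type*} [Group M] (P : Subgroup M)

/-- Park's group of the `P`-`P`-biset `M` (with `P` acting on both sides by multiplication):
the group of bijections of `M` preserving the right `P`-action. -/
def ParkGroup : Subgroup (Equiv.Perm M) where
  carrier := {f | ∀ m : M, ∀ u ∈ P, f (m * u) = f m * u}
  one_mem' := fun _ _ _ => rfl
  mul_mem' := by
    intro f g hf hg m u hu
    rw [Equiv.Perm.mul_apply, Equiv.Perm.mul_apply, hg m u hu, hf _ u hu]
  inv_mem' := by
    intro f hf m u hu
    apply f.injective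
    rw [hf _ u hu]
    simp

/-- Park's embedding `ι : P → G`, `u ↦ (m ↦ u m)`. -/
def parkEmbedding : P →* ParkGroup P where
  toFun u := ⟨Equiv.mulLeft (u : M), fun m v _ => (mul_assoc (u : M) m v).symm⟩
  map_one' := by ext; simp
  map_mul' u v := by ext; simp

end Park

/-! ### Indecomposable representations and Scott modules -/

section Scott

variable {k : Type*} [Field k] {G : Type*} [Group G] {V : Type*} [AddCommGroup V] [Module k V]

/-- A representation is indecomposable if it is non-zero and is not the internal direct sum of
two non-zero subrepresentations. -/
def IsIndecomposableRep (σ : Representation k G V) : Prop :=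
  Nontrivial V ∧ ∀ U W : Subrepresentation σ, IsCompl U W → U = ⊥ ∨ W = ⊥

variable (k) in
/-- The induced module `Ind_H^G(k_H)` of the trivial `kH`-module. -/
noncomputable abbrev indTrivial (H : Subgroup G) :
    Representation k G (Representation.IndV H.subtype (Representation.trivial k H k)) :=
  Representation.ind H.subtype (Representation.trivial k H k)

/-- `σ` is a Scott module `Sc(G, H)`: it is indecomposable, it is (isomorphic to) a direct summand
of `Ind_H^G(k_H)`, and it has the trivial module `k_G` in its socle, that is, it has a non-zero
`G`-fixed vector. -/
def IsScottModule (H : Subgroup G) (σ : Representation k G V) : Prop :=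
  IsIndecomposableRep σ ∧
  (∃ (i : σ.IntertwiningMap (indTrivial k H)) (r : (indTrivial k H).IntertwiningMap σ),
    ∀ v, r (i v) = v) ∧
  ∃ v : V, v ≠ 0 ∧ ∀ g, σ g v = v

end Scott

/-! ### The Brauer quotient -/

section Brauer

variable {k : Type*} [Field k] {G : Type*} [Group G] {V : Type*} [AddCommGroup V] [Module k V]
  (σ : Representation k G V)

/-- The fixed points `M^Q` of a subgroup `Q`. -/
noncomputable def fixedSubmodule (Q : Subgroup G) : Submodule k V :=
  Representation.invariants (σ.comp Q.subtype)

lemma mem_fixedSubmodule {Q : Subgroup G} {v : V} :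
    v ∈ fixedSubmodule σ Q ↔ ∀ g ∈ Q, σ g v = v :=
  ⟨fun h g hg => h ⟨g, hg⟩, fun h g => h g g.2⟩

/-- For `R ≤ Q`, the sum of the action of a set of representatives of the left cosets of `R` in
`Q`. On `M^R` it is the relative trace map `Tr_R^Q : M^R → M^Q`, independent of the choice of the
representatives (see `relTrace_eq_sum`). -/
noncomputable def relTrace (R Q : Subgroup G) : V →ₗ[k] V :=
  ∑ᶠ q : Q ⧸ R.subgroupOf Q, σ (q.out : G)

lemma apply_eq_of_mk_eq {R Q : Subgroup G} {v : V} (hv : v ∈ fixedSubmodule σ R) {x y : Q}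
    (h : (x : Q ⧸ R.subgroupOf Q) = y) : σ (x : G) v = σ (y : G) v := by
  have h' : ((x : G)⁻¹ * y) ∈ R :=
    Subgroup.mem_subgroupOf.1 (QuotientGroup.eq.1 h)
  have h2 := (mem_fixedSubmodule σ).1 hv _ h'
  calc σ (x : G) v = σ (x : G) (σ ((x : G)⁻¹ * y) v) := by rw [h2]
    _ = σ (y : G) v := by rw [← Module.End.mul_apply, ← map_mul, mul_inv_cancel_left]

/-- The relative trace may be computed with any set of coset representatives. -/
lemma relTrace_eq_sum [Finite G] {R Q : Subgroup G} {v : V} (hv : v ∈ fixedSubmodule σ R)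
    {ι : Type*} [Fintype ι] (s : ι → Q)
    (hs : Function.Bijective fun i => (s i : Q ⧸ R.subgroupOf Q)) :
    relTrace σ R Q v = ∑ i, σ (s i : G) v := by
  let _ := Fintype.ofFinite (Q ⧸ R.subgroupOf Q)
  rw [relTrace, finsum_eq_sum_of_fintype, LinearMap.sum_apply]
  refine (Fintype.sum_bijective _ hs _ _ fun i => ?_).symm
  exact apply_eq_of_mk_eq σ hv (Quotient.out_eq _).symm

/-- The subspace `∑_{R < Q} Tr_R^Q(M^R)`. -/
noncomputable def traceSubmodule (Q : Subgroup G) : Submodule k V :=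
  ⨆ R : {R : Subgroup G // R < Q}, (fixedSubmodule σ R.1).map (relTrace σ R.1 Q)

lemma traceSubmodule_le [Finite G] (Q : Subgroup G) :
    traceSubmodule σ Q ≤ fixedSubmodule σ Q := by
  refine iSup_le fun R => ?_
  rintro _ ⟨v, hv, rfl⟩
  refine (mem_fixedSubmodule σ).2 fun g hg => ?_
  let _ := Fintype.ofFinite (Q ⧸ R.1.subgroupOf Q)
  have h1 := relTrace_eq_sum σ hv (fun q : Q ⧸ R.1.subgroupOf Q => q.out)
    (by simp)
  have h2 := relTrace_eq_sum σ hv (fun q : Q ⧸ R.1.subgroupOf Q => (⟨g, hg⟩ : Q) * q.out) (by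
    have : (fun q : Q ⧸ R.1.subgroupOf Q =>
        (((⟨g, hg⟩ : Q) * q.out : Q) : Q ⧸ R.1.subgroupOf Q)) =
        fun q => (⟨g, hg⟩ : Q) • q := by
      funext q
      conv_rhs => rw [← Quotient.out_eq q]
      rfl
    rw [this]
    exact MulAction.bijective _)
  conv_lhs => rw [h1]
  rw [h2, map_sum]
  simp [map_mul]

lemma fixedSubmodule_le_comap (Q : Subgroup G) (n : Subgroup.normalizer (Q : Set G)) :
    fixedSubmodule σ Q ≤ (fixedSubmodule σ Q).comap (σ (n : G)) := by
  intro v hv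
  refine (mem_fixedSubmodule σ).2 fun g hg => ?_
  have hg' : (n : G)⁻¹ * g * n ∈ Q := by
    have := (Subgroup.mem_normalizer_iff.1 (inv_mem n.2) g).1 hg
    simpa using this
  have h := (mem_fixedSubmodule σ).1 hv _ hg'
  calc σ g (σ (n : G) v) = σ (n : G) (σ ((n : G)⁻¹ * g * n) v) := by
        rw [← Module.End.mul_apply, ← Module.End.mul_apply, ← map_mul, ← map_mul]
        congr 2; group
    _ = σ (n : G) v := by rw [h]

lemma traceSubmodule_le_comap [Finite G] (Q : Subgroup G)
    (n : Subgroup.normalizer (Q : Set G)) :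
    traceSubmodule σ Q ≤ (traceSubmodule σ Q).comap (σ (n : G)) := by
  refine iSup_le fun R => ?_
  rintro _ ⟨v, hv, rfl⟩
  have hc : ∀ x : G, x ∈ Q ↔ (n : G) * x * (n : G)⁻¹ ∈ Q := fun x =>
    Subgroup.mem_normalizer_iff.1 n.2 x
  let R' : Subgroup G := R.1.map (MulAut.conj (n : G)).toMonoidHom
  have hR' : ∀ x : G, (n : G) * x * (n : G)⁻¹ ∈ R' ↔ x ∈ R.1 := by
    intro x
    constructor
    · rintro ⟨y, hy, hxy⟩
      have : y = x := (MulAut.conj (n : G)).injective hxy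
      exact this ▸ hy
    · exact fun hx => ⟨x, hx, rfl⟩
  have hlt : R' < Q := by
    refine lt_of_le_of_ne ?_ ?_
    · rintro _ ⟨y, hy, rfl⟩
      exact (hc y).1 (R.2.le hy)
    · intro h
      refine R.2.not_ge fun x hx => ?_
      exact (hR' x).1 (h.ge ((hc x).1 hx))
  have hw : σ (n : G) v ∈ fixedSubmodule σ R' := by
    refine (mem_fixedSubmodule σ).2 ?_
    rintro _ ⟨y, hy, rfl⟩
    have h := (mem_fixedSubmodule σ).1 hv _ hy
    conv_rhs => rw [← h]
    rw [← Module.End.mul_apply, ← Module.End.mul_apply, ← map_mul, ← map_mul]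
    congr 2
    simp
  let _ := Fintype.ofFinite (Q ⧸ R.1.subgroupOf Q)
  let c : Q → Q := fun q => ⟨(n : G) * q * (n : G)⁻¹, (hc q).1 q.2⟩
  have hcc : ∀ x y : Q, ((c x : Q) : Q ⧸ R'.subgroupOf Q) = c y ↔
      (x : Q ⧸ R.1.subgroupOf Q) = y := by
    intro x y
    rw [QuotientGroup.eq, QuotientGroup.eq, Subgroup.mem_subgroupOf, Subgroup.mem_subgroupOf,
      ← hR']
    have : (((c x)⁻¹ * c y : Q) : G) = (n : G) * ((x⁻¹ * y : Q) : G) * (n : G)⁻¹ := by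
      simp only [c, Subgroup.coe_mul, Subgroup.coe_inv]
      group
    rw [this]
  have h1 := relTrace_eq_sum σ hv (fun q : Q ⧸ R.1.subgroupOf Q => q.out)
    (by simp)
  have h2 := relTrace_eq_sum σ hw (fun q : Q ⧸ R.1.subgroupOf Q => c q.out) (by
    constructor
    · intro a b hab
      have := (hcc _ _).1 hab
      simpa using this
    · intro b
      obtain ⟨y, rfl⟩ := QuotientGroup.mk_surjective b
      have hy : (n : G)⁻¹ * y * n ∈ Q := by
        rw [hc]; simp [mul_assoc]
      refine ⟨((⟨_, hy⟩ : Q) : Q ⧸ R.1.subgroupOf Q), ?_⟩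
      have h3 : y = c ⟨_, hy⟩ := by
        apply Subtype.ext; simp [c, mul_assoc]
      conv_rhs => rw [h3]
      exact (hcc _ _).2 (Quotient.out_eq _))
  refine Submodule.mem_iSup_of_mem (⟨R', hlt⟩ : {R : Subgroup G // R < Q}) ?_
  refine ⟨σ (n : G) v, hw, ?_⟩
  rw [h2, h1, map_sum]
  refine Finset.sum_congr rfl fun q _ => ?_
  rw [← Module.End.mul_apply, ← Module.End.mul_apply, ← map_mul, ← map_mul]
  congr 2
  simp [c]

/-- The underlying space of the Brauer quotient `M(Q) = M^Q / ∑_{R < Q} Tr_R^Q(M^R)`. -/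
abbrev BrauerQuotient (Q : Subgroup G) : Type _ :=
  fixedSubmodule σ Q ⧸ (traceSubmodule σ Q).submoduleOf (fixedSubmodule σ Q)

/-- The fixed points `M^Q` as a `kN_G(Q)`-module. -/
noncomputable def fixedRep (Q : Subgroup G) :
    Representation k (Subgroup.normalizer (Q : Set G)) (fixedSubmodule σ Q) :=
  Representation.subrepresentation (σ.comp (Subgroup.normalizer (Q : Set G)).subtype)
    (fixedSubmodule σ Q) (fixedSubmodule_le_comap σ Q)

/-- The Brauer quotient `M(Q)` as a `kN_G(Q)`-module. -/
noncomputable def brauerRep [Finite G] (Q : Subgroup G) :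
    Representation k (Subgroup.normalizer (Q : Set G)) (BrauerQuotient σ Q) :=
  Representation.quotient (fixedRep σ Q)
    ((traceSubmodule σ Q).submoduleOf (fixedSubmodule σ Q))
    fun n _ hv => traceSubmodule_le_comap σ Q n hv

lemma sup_centralizer_le_normalizer (Q : Subgroup G) :
    Q ⊔ Subgroup.centralizer (Q : Set G) ≤ Subgroup.normalizer (Q : Set G) := by
  refine sup_le Subgroup.le_normalizer ?_
  intro g hg
  refine Subgroup.mem_normalizer_iff.2 fun x => ?_
  have hg' := Subgroup.mem_centralizer_iff.1 hg
  constructor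
  · intro hx
    rw [← hg' x hx]; simpa using hx
  · intro hx
    have := hg' _ hx
    have h2 : g * x = x * g := by
      have h3 : g * (g * x * g⁻¹) = g * x := by rw [← this]; group
      have h4 : g * x * g⁻¹ = x := mul_left_cancel h3
      exact mul_inv_eq_iff_eq_mul.1 h4
    have h5 : g * x * g⁻¹ = x := by rw [h2]; group
    rwa [h5] at hx

/-- A `kG`-module `M` is Brauer indecomposable if, for every `p`-subgroup `Q` of `G`, the Brauer
quotient `M(Q)` is zero or is indecomposable as a `k(Q C_G(Q))`-module. -/
def IsBrauerIndecomposable [Finite G] (p : ℕ) (σ : Representation k G V) : Prop :=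
  ∀ Q : Subgroup G, IsPGroup p Q →
    Subsingleton (BrauerQuotient σ Q) ∨
    IsIndecomposableRep ((brauerRep σ Q).comp
      (Subgroup.inclusion (sup_centralizer_le_normalizer Q)))

end Brauer

/-! Left multiplication embeds the whole of `M`, not only `P`, in Park's group `G`; put `X = G/M`.
As `|M : P| = 3` is invertible in `k`, the permutation module `k[X]` is a direct summand of
`Ind_{ιP}^G(k)`. Moreover `|G| = 6·2^(3n)`, and `|X|` is a power of `2`, so a `2`-subgroup of `G` is
transitive on `X`. In characteristic `2` a module generated by one vector over a `2`-subgroup is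
indecomposable (`isIndecomposableRep_of_span_eq_top`), hence `k[X]` is a Scott module;
`IsScottModule.exists_basis` shows that every Scott module is isomorphic to it.

The Brauer quotient of a permutation module at `Q` is spanned by the images of the points of `X`
fixed by `Q`. By the same criterion it is indecomposable or zero once a `2`-subgroup of `C_G(Q)` is
transitive on these points. Two facts give this, after conjugating `Q` into `M`. First, `C_G(Q)` is
transitive on them, because conjugation in `G` from one `2`-subgroup of `M` to another is already
induced by `M` (`exists_mem_centralizer_smul_eq`). Secondly, the number of these points is a power
of `2`: the order of `C_G(Q)` has at most one factor `3`, and if it has one, so has the order of the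
point stabilizer `C_M(Q)` (`three_dvd_card_centralizer`). A Sylow `2`-subgroup of `C_G(Q)` is then
transitive too. -/

/-! ### Representations of `p`-groups in characteristic `p` -/

section RepresentationTheory

open Module

variable {k : Type*} [Field k]

/-- A `p`-group acting additively on a non-zero `𝔽_p`-space has a non-zero fixed vector. -/
lemma IsPGroup.exists_ne_zero_forall_apply_eq_of_zmod {p : ℕ} [Fact p.Prime]
    {D : Type*} [Group D] [Finite D] (hD : IsPGroup p D)
    {V : Type*} [AddCommGroup V] [Module (ZMod p) V] [Module k V] [Nontrivial V]
    (ρ : Representation k D V) :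
    ∃ v : V, v ≠ 0 ∧ ∀ d, ρ d v = v := by
  obtain ⟨v, hv⟩ := exists_ne (0 : V)
  -- The `𝔽_p`-span of an orbit is finite even if `k` is infinite. Its order is divisible by `p`, so
  -- the fixed vector `0` cannot be the only one.
  let A : Submodule (ZMod p) V := Submodule.span (ZMod p) (Set.range fun d => ρ d v)
  have : Module.Finite (ZMod p) A := Module.Finite.span_of_finite _ (Set.finite_range _)
  have : Finite A := Module.finite_of_finite (ZMod p)
  have hA : ∀ d, ∀ x ∈ A, ρ d x ∈ A := by
    intro d x hx
    have : A ≤ A.comap ((ρ d).toAddMonoidHom.toZModLinearMap p) := by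
      rw [Submodule.span_le]
      rintro _ ⟨e, rfl⟩
      exact Submodule.subset_span ⟨d * e, by simp⟩
    exact this hx
  let : MulAction D A :=
    { smul := fun d x => ⟨ρ d x, hA d x x.2⟩
      one_smul := fun x => Subtype.ext (by change ρ 1 (x : V) = x; simp)
      mul_smul := fun d e x => Subtype.ext (by
        change ρ (d * e) (x : V) = ρ d (ρ e x); simp) }
  have hvA : v ∈ A := Submodule.subset_span ⟨1, by simp⟩
  have hdvd : p ∣ Nat.card A := by
    have hp : p • v = 0 := by rw [← Nat.cast_smul_eq_nsmul (ZMod p)]; simp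
    have h1 : addOrderOf (⟨v, hvA⟩ : A) = p :=
      addOrderOf_eq_prime (Subtype.ext hp) fun h => hv (congrArg Subtype.val h)
    exact h1.symm.dvd.trans (addOrderOf_dvd_natCard _)
  obtain ⟨x, hx, hx0⟩ := hD.exists_fixed_point_of_prime_dvd_card_of_fixed_point A hdvd
    (a := 0) (fun d => Subtype.ext (map_zero (ρ d)))
  exact ⟨x, fun h => hx0 (Subtype.ext h.symm), fun d => congrArg Subtype.val (hx d)⟩

/-- A `p`-group acting on a non-zero space in characteristic `p` has a non-zero fixed vector. -/
lemma IsPGroup.exists_ne_zero_forall_apply_eq {p : ℕ} [Fact p.Prime] [CharP k p]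
    {D : Type*} [Group D] [Finite D] (hD : IsPGroup p D)
    {V : Type*} [AddCommGroup V] [Module k V] [Nontrivial V] (ρ : Representation k D V) :
    ∃ v : V, v ≠ 0 ∧ ∀ d, ρ d v = v := by
  let _ : Module (ZMod p) V := AddCommGroup.zmodModule (n := p) fun x => by
    rw [← Nat.cast_smul_eq_nsmul k, CharP.cast_eq_zero, zero_smul]
  exact hD.exists_ne_zero_forall_apply_eq_of_zmod ρ

/-- A fixed vector in the dual of `V ⧸ W`, pulled back to `V`. -/
lemma IsPGroup.exists_invariant_functional {p : ℕ} [Fact p.Prime] [CharP k p]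
    {D : Type*} [Group D] [Finite D] (hD : IsPGroup p D)
    {V : Type*} [AddCommGroup V] [Module k V] (ρ : Representation k D V)
    (W : Submodule k V) (hW : ∀ d, W ≤ W.comap (ρ d)) (hW' : W ≠ ⊤) :
    ∃ F : V →ₗ[k] k, F ≠ 0 ∧ (∀ w ∈ W, F w = 0) ∧ ∀ d v, F (ρ d v) = F v := by
  have : Nontrivial (V ⧸ W) := Submodule.Quotient.nontrivial_iff.2 hW'
  obtain ⟨φ, hφ, hinv⟩ := hD.exists_ne_zero_forall_apply_eq (ρ.quotient W hW).dual
  refine ⟨φ ∘ₗ W.mkQ, ?_, ?_, ?_⟩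
  · intro h
    apply hφ
    ext x
    simpa using LinearMap.congr_fun h x
  · intro w hw
    simp [(Submodule.Quotient.mk_eq_zero W).2 hw]
  · intro d v
    have := LinearMap.congr_fun (hinv d⁻¹) (W.mkQ v)
    simpa [Dual.transpose_apply] using this

/-- In characteristic `p`, a representation generated by one vector over a `p`-subgroup
is indecomposable. -/
lemma isIndecomposableRep_of_span_eq_top {p : ℕ} [Fact p.Prime] [CharP k p]
    {G : Type*} [Group G] {V : Type*} [AddCommGroup V] [Module k V] [Nontrivial V]
    (σ : Representation k G V) (D : Subgroup G) [Finite D] (hD : IsPGroup p D) (v : V)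
    (hv : Submodule.span k (Set.range fun d : D => σ d v) = ⊤) : IsIndecomposableRep σ := by
  refine ⟨inferInstance, fun U W hUW => ?_⟩
  by_contra! hne
  have hsup : U.toSubmodule ⊔ W.toSubmodule = ⊤ :=
    congrArg Subrepresentation.toSubmodule hUW.sup_eq_top
  have hinf : U.toSubmodule ⊓ W.toSubmodule = ⊥ :=
    congrArg Subrepresentation.toSubmodule hUW.inf_eq_bot
  have hU : U.toSubmodule ≠ ⊥ := fun h => hne.1 (Subrepresentation.toSubmodule_injective h)
  have hW : W.toSubmodule ≠ ⊥ := fun h => hne.2 (Subrepresentation.toSubmodule_injective h)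
  -- A `D`-invariant functional is determined by its value at the generator `v`, so a non-zero one
  -- does not vanish there.
  have key : ∀ S : Subrepresentation σ, S.toSubmodule ≠ ⊤ →
      ∃ F : V →ₗ[k] k, F v ≠ 0 ∧ (∀ w ∈ S.toSubmodule, F w = 0) ∧
        ∀ d : D, ∀ x, F (σ d x) = F x := by
    intro S hS
    obtain ⟨F, hF, hFS, hinv⟩ := hD.exists_invariant_functional (σ.comp D.subtype) S.toSubmodule
      (fun d x hx => S.apply_mem_toSubmodule d hx) hS
    refine ⟨F, fun h0 => hF ?_, hFS, hinv⟩
    rw [← LinearMap.ker_eq_top, eq_top_iff, ← hv, Submodule.span_le]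
    rintro _ ⟨d, rfl⟩
    exact (hinv d v).trans h0
  obtain ⟨F, hFv, hFU, hF⟩ := key U fun h => hW (by rwa [h, top_inf_eq] at hinf)
  obtain ⟨E, hEv, hEW, hE⟩ := key W fun h => hU (by rwa [h, inf_top_eq] at hinf)
  -- Both terms are `D`-invariant and agree at `v`, so they are equal. Thus `E` is proportional to
  -- `F` and kills `U` as well as `W`, hence everything.
  have hEF : LinearMap.ker (E v • F - F v • E) = ⊤ := by
    rw [eq_top_iff, ← hv, Submodule.span_le]
    rintro _ ⟨d, rfl⟩
    simp [hF, hE, mul_comm]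
  have hU0 : ∀ u ∈ U.toSubmodule, E u = 0 := by
    intro u hu
    have h : (E v • F - F v • E) u = 0 := by
      rw [← LinearMap.mem_ker, hEF]; trivial
    simpa [hFU u hu, hFv] using h
  have hE0 : LinearMap.ker E = ⊤ := by
    rw [eq_top_iff, ← hsup]
    exact sup_le hU0 hEW
  exact hEv (by rw [← LinearMap.mem_ker, hE0]; trivial)

/-! ### Brauer quotients of permutation modules -/

section PermutationBasis

variable {G : Type*} [Group G] {X : Type*} [MulAction G X]
  {V : Type*} [AddCommGroup V] [Module k V] {σ : Representation k G V}
  (b : Basis X k V) (hb : ∀ g x, σ g (b x) = b (g • x))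

include hb


/-- A `Q`-fixed vector has constant coefficients on each `Q`-orbit of the basis. The sum over a
non-trivial orbit is a trace from a point stabilizer, a proper subgroup of `Q`, so only the fixed
points survive modulo traces. -/
lemma fixedSubmodule_le_span_sup_traceSubmodule [Finite G] [Finite X] (Q : Subgroup G) :
    fixedSubmodule σ Q ≤
      Submodule.span k (b '' {x | ∀ q ∈ Q, q • x = x}) ⊔ traceSubmodule σ Q := by
  classical
  let _ := Fintype.ofFinite X
  let _ := Fintype.ofFinite (MulAction.orbitRel.Quotient Q X)
  intro v hv
  have hinv : ∀ (q : Q) x, b.repr v (q • x) = b.repr v x := by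
    intro q x
    have h1 : σ (q : G) v = v := (mem_fixedSubmodule σ).1 hv q q.2
    have h2 : σ (q : G) v = ∑ y, b.repr v y • b ((q : G) • y) := by
      conv_lhs => rw [← b.sum_repr v, map_sum]
      exact Finset.sum_congr rfl fun y _ => by rw [map_smul, hb]
    have h3 : σ (q : G) v = ∑ y, b.repr v ((q : G)⁻¹ • y) • b y := by
      rw [h2]
      exact Fintype.sum_equiv (MulAction.toPerm (q : G)) _ _ fun y => by simp
    have h4 := congrArg (fun w => b.repr w (q • x)) h3
    simp only [h1, Basis.repr_sum_self] at h4
    rw [h4]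
    simp [Subgroup.smul_def]
  rw [← b.sum_repr v, ← Finset.sum_fiberwise (s := Finset.univ)
    (g := fun x : X => (Quotient.mk _ x : MulAction.orbitRel.Quotient Q X))]
  refine Submodule.sum_mem _ fun ω _ => ?_
  obtain ⟨x₀, rfl⟩ := Quotient.mk_surjective ω
  have horb : ∀ x, (Quotient.mk _ x : MulAction.orbitRel.Quotient Q X) = Quotient.mk _ x₀ ↔
      ∃ q : Q, q • x₀ = x := fun x => by
    rw [Quotient.eq]; exact MulAction.mem_orbit_iff
  have hsum : ∑ x with (Quotient.mk _ x : MulAction.orbitRel.Quotient Q X) = Quotient.mk _ x₀,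
      b.repr v x • b x = b.repr v x₀ •
        ∑ x with (Quotient.mk _ x : MulAction.orbitRel.Quotient Q X) = Quotient.mk _ x₀, b x := by
    rw [Finset.smul_sum]
    refine Finset.sum_congr rfl fun x hx => ?_
    obtain ⟨q, rfl⟩ := (horb x).1 (Finset.mem_filter.1 hx).2
    rw [hinv]
  rw [hsum]
  refine Submodule.smul_mem _ _ ?_
  by_cases hfix : ∀ q ∈ Q, q • x₀ = x₀
  · refine Submodule.mem_sup_left (Submodule.sum_mem _ fun x hx => ?_)
    obtain ⟨q, rfl⟩ := (horb x).1 (Finset.mem_filter.1 hx).2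
    refine Submodule.subset_span ⟨_, ?_, rfl⟩
    have : q • x₀ = x₀ := hfix q q.2
    rwa [this]
  · let R : Subgroup G := MulAction.stabilizer G x₀ ⊓ Q
    have hR : R < Q := by
      refine lt_of_le_of_ne inf_le_right fun h => hfix fun q hq => ?_
      exact (h.ge hq).1
    refine Submodule.mem_sup_right (Submodule.mem_iSup_of_mem ⟨R, hR⟩ ⟨b x₀, ?_, ?_⟩)
    · exact (mem_fixedSubmodule σ).2 fun g hg => by rw [hb, hg.1]
    · have hmem : b x₀ ∈ fixedSubmodule σ R :=
        (mem_fixedSubmodule σ).2 fun g hg => by rw [hb, hg.1]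
      choose s hs using fun x : {x // (Quotient.mk _ x : MulAction.orbitRel.Quotient Q X) =
        Quotient.mk _ x₀} => (horb x).1 x.2
      rw [relTrace_eq_sum σ hmem s, Finset.sum_subtype (p := fun x =>
        (Quotient.mk _ x : MulAction.orbitRel.Quotient Q X) = Quotient.mk _ x₀) _ (by simp)]
      · refine Finset.sum_congr rfl fun x _ => ?_
        rw [hb, ← hs x, Subgroup.smul_def]
      · have hcoset : ∀ p q : Q, (p : Q ⧸ R.subgroupOf Q) = q ↔ p • x₀ = q • x₀ := by
          intro p q
          rw [QuotientGroup.eq, Subgroup.mem_subgroupOf, Subgroup.mem_inf,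
            MulAction.mem_stabilizer_iff, ← Subgroup.smul_def, mul_smul, inv_smul_eq_iff]
          exact (and_iff_left (mul_mem (inv_mem p.2) q.2)).trans eq_comm
        constructor
        · intro x y hxy
          have := (hcoset _ _).1 hxy
          rw [hs, hs] at this
          exact Subtype.ext this
        · intro c
          obtain ⟨q, rfl⟩ := QuotientGroup.mk_surjective c
          exact ⟨⟨q • x₀, (horb _).2 ⟨q, rfl⟩⟩, (hcoset _ _).2 (hs _)⟩

/-- The `Q`-fixed basis vectors span the Brauer quotient and form one orbit of the `p`-subgroup `D`
of the centralizer, so any of them generates it over `D`. -/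
lemma subsingleton_or_isIndecomposableRep_brauerRep [Finite G] [Finite X]
    {p : ℕ} [Fact p.Prime] [CharP k p] (Q : Subgroup G)
    (hQ : ∀ x : X, (∀ q ∈ Q, q • x = x) → ∃ D ≤ Subgroup.centralizer (Q : Set G), IsPGroup p D ∧
      ∀ y : X, (∀ q ∈ Q, q • y = y) → ∃ d ∈ D, d • x = y) :
    Subsingleton (BrauerQuotient σ Q) ∨
    IsIndecomposableRep ((brauerRep σ Q).comp
      (Subgroup.inclusion (sup_centralizer_le_normalizer Q))) := by
  rcases subsingleton_or_nontrivial (BrauerQuotient σ Q) with hss | hnt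
  · exact .inl hss
  right
  have hle := fixedSubmodule_le_span_sup_traceSubmodule b hb Q
  obtain ⟨x, hx⟩ : ∃ x : X, ∀ q ∈ Q, q • x = x := by
    by_contra! h
    have : {x : X | ∀ q ∈ Q, q • x = x} = ∅ :=
      Set.eq_empty_of_forall_notMem fun x hx => by
        obtain ⟨q, hq, hne⟩ := h x
        exact hne (hx q hq)
    rw [this, Set.image_empty, Submodule.span_empty, bot_sup_eq] at hle
    refine not_subsingleton _ (Submodule.Quotient.subsingleton_iff.2 ?_ :
      Subsingleton (BrauerQuotient σ Q))
    exact Submodule.submoduleOf_eq_top.2 hle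
  obtain ⟨D, hDC, hD, htrans⟩ := hQ x hx
  let π := ((traceSubmodule σ Q).submoduleOf (fixedSubmodule σ Q)).mkQ
  have hfix : ∀ y : X, (∀ q ∈ Q, q • y = y) → b y ∈ fixedSubmodule σ Q := fun y hy =>
    (mem_fixedSubmodule σ).2 fun g hg => by rw [hb, hy g hg]
  let D' : Subgroup ↥(Q ⊔ Subgroup.centralizer (Q : Set G)) := D.subgroupOf _
  have hD' : IsPGroup p D' := hD.comap_subtype
  refine isIndecomposableRep_of_span_eq_top _ D' hD' (π ⟨b x, hfix x hx⟩) ?_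
  set N := Submodule.span k (Set.range fun d : D' =>
    ((brauerRep σ Q).comp (Subgroup.inclusion (sup_centralizer_le_normalizer Q))) d
      (π ⟨b x, hfix x hx⟩)) with hN
  have hsub : Submodule.span k (b '' {x | ∀ q ∈ Q, q • x = x}) ⊔ traceSubmodule σ Q ≤
      (N.comap π).map (fixedSubmodule σ Q).subtype := by
    refine sup_le (Submodule.span_le.2 ?_) fun t ht => ?_
    · rintro _ ⟨y, hy, rfl⟩
      refine ⟨⟨b y, hfix y hy⟩, ?_, rfl⟩
      obtain ⟨d, hd, rfl⟩ := htrans y hy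
      refine Submodule.subset_span
        ⟨⟨⟨d, Subgroup.mem_sup_right (hDC hd)⟩, Subgroup.mem_subgroupOf.2 hd⟩, ?_⟩
      refine congrArg π (Subtype.ext ?_)
      exact hb d x
    · refine ⟨⟨t, traceSubmodule_le σ Q ht⟩, ?_, rfl⟩
      have : π ⟨t, traceSubmodule_le σ Q ht⟩ = 0 := (Submodule.Quotient.mk_eq_zero _).2 ht
      rw [SetLike.mem_coe, Submodule.mem_comap, this]
      exact N.zero_mem
  rw [eq_top_iff]
  intro z _
  obtain ⟨v, rfl⟩ := Submodule.mkQ_surjective _ z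
  obtain ⟨w, hw, hwv⟩ := hsub (hle v.2)
  obtain rfl : w = v := Subtype.ext hwv
  exact hw

end PermutationBasis

end RepresentationTheory

/-! ### Scott modules as permutation modules -/

section ScottModule

open Module Representation

variable {k : Type*} [Field k] {G : Type*} [Group G]

lemma exists_basis_ofMulAction (Y : Type*) [MulAction G Y] :
    ∃ c : Basis Y k (MonoidAlgebra k Y), ∀ g y, ofMulAction k G Y g (c y) = c (g • y) := by
  refine ⟨Basis.ofRepr (MonoidAlgebra.coeffLinearEquiv k), fun g y => ?_⟩
  have h : ∀ y, Basis.ofRepr (MonoidAlgebra.coeffLinearEquiv k) y =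
      (MonoidAlgebra.single y 1 : MonoidAlgebra k Y) := fun y => by
    simp [Basis.coe_ofRepr]
  rw [h, h, ofMulAction_single]

/-- The induced module of the trivial module is the permutation module on the cosets. -/
lemma exists_basis_indTrivial (H : Subgroup G) :
    ∃ b : Basis (G ⧸ H) k (IndV H.subtype (Representation.trivial k H k)),
      ∀ g x, indTrivial k H g (b x) = b (g • x) := by
  -- The group acts on the generators of `IndV` by right multiplication with inverses; indexing by
  -- `g⁻¹` turns this into left translation, compatible with left cosets.
  let e : G → IndV H.subtype (Representation.trivial k H k) := fun g =>
    IndV.mk H.subtype (Representation.trivial k H k) g⁻¹ 1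
  have he : ∀ g h : G, indTrivial k H g (e h) = e (g * h) := by
    intro g h
    simp only [e, indTrivial, ind_mk, mul_inv_rev]
  have heH : ∀ (g : G) (h : H), e (g * h) = e g := by
    intro g h
    have := Coinvariants.mk_self_apply (Representation.tprod ((leftRegular k G).comp H.subtype)
      (Representation.trivial k H k)) h⁻¹ (TensorProduct.tmul k (MonoidAlgebra.single g⁻¹ 1) 1)
    simpa [e] using this
  let f : G ⧸ H → IndV H.subtype (Representation.trivial k H k) := fun x =>
    Quotient.liftOn' x e fun a c hac => by
      have := heH a ⟨a⁻¹ * c, QuotientGroup.leftRel_apply.1 hac⟩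
      simpa using this.symm
  have hf : ∀ g : G, f (g : G ⧸ H) = e g := fun _ => rfl
  let L : IndV H.subtype (Representation.trivial k H k) →ₗ[k] ((G ⧸ H) →₀ k) :=
    Coinvariants.lift _ (TensorProduct.lift
      ((Finsupp.lift _ k _ fun g : G => LinearMap.toSpanSingleton k _
        (Finsupp.single ((g⁻¹ : G) : G ⧸ H) 1)) ∘ₗ
        (MonoidAlgebra.coeffLinearEquiv k).toLinearMap)) fun h => by
      ext g : 4
      simp [ofMulAction_single]
  have hL : ∀ g, L (e g) = Finsupp.single (g : G ⧸ H) 1 := by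
    intro g
    simp [L, e]
  let E : IndV H.subtype (Representation.trivial k H k) ≃ₗ[k] ((G ⧸ H) →₀ k) :=
    LinearEquiv.ofLinearMap L (Finsupp.linearCombination k f)
      (by
        ext x : 2
        obtain ⟨g, rfl⟩ := QuotientGroup.mk_surjective x
        simp [hf, hL])
      (by
        refine IndV.hom_ext _ _ fun g => LinearMap.ext_ring ?_
        have := hL g⁻¹
        simp only [e, inv_inv] at this
        simp only [LinearMap.comp_apply] at this ⊢
        rw [this]
        simp [hf, e])
  have hE : ∀ x, Basis.ofRepr E x = f x := fun x => by
    rw [Basis.coe_ofRepr]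
    simp [E]
  refine ⟨Basis.ofRepr E, fun g x => ?_⟩
  obtain ⟨h, rfl⟩ := QuotientGroup.mk_surjective x
  rw [hE, hE, hf, he]
  rfl

section TwoBases

variable {X Y : Type*} [MulAction G X] [MulAction G Y]
  {W V₀ V : Type*} [AddCommGroup W] [Module k W] [AddCommGroup V₀] [Module k V₀]
  [AddCommGroup V] [Module k V]
  {τ : Representation k G W} {ρ : Representation k G V₀} {σ : Representation k G V}
  (b : Basis X k W) (hb : ∀ g x, τ g (b x) = b (g • x))
  (c : Basis Y k V₀) (hc : ∀ g y, ρ g (c y) = c (g • y))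
  (π : X → Y) (hπ : ∀ (g : G) x, π (g • x) = g • π x)

/-- The map of permutation modules given by an equivariant map of `G`-sets. -/
noncomputable def permutationPush : τ.IntertwiningMap ρ where
  toLinearMap := b.constr k fun x => c (π x)
  isIntertwining' g := b.ext fun x => by simp [hb, hc, hπ]

lemma permutationPush_apply (x : X) : permutationPush b hb c hc π hπ (b x) = c (π x) :=
  b.constr_basis k _ x

variable [Fintype X]

open Classical in
/-- The map of permutation modules that sends a point to the sum of its fibre. -/
noncomputable def permutationPull : ρ.IntertwiningMap τ where
  toLinearMap := c.constr k fun y => ∑ x with π x = y, b x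
  isIntertwining' g := c.ext fun y => by
    simp only [LinearMap.comp_apply, hc, Basis.constr_basis, map_sum, hb]
    refine (Finset.sum_bij (fun x _ => g • x) ?_ ?_ ?_ ?_).symm
    · simp +contextual [hπ]
    · simp
    · intro x hx
      refine ⟨g⁻¹ • x, ?_, by simp⟩
      have := (Finset.mem_filter.1 hx).2
      simp [hπ, this]
    · simp

open Classical in
lemma permutationPull_apply (y : Y) :
    permutationPull b hb c hc π hπ (c y) = ∑ x with π x = y, b x :=
  c.constr_basis k _ y

lemma permutationPull_sum [Fintype Y] :
    permutationPull b hb c hc π hπ (∑ y, c y) = ∑ x, b x := by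
  classical
  rw [map_sum]
  simp only [permutationPull_apply]
  exact Finset.sum_fiberwise _ _ _

/-- Pulling back and pushing forward counts the fibre. When `m` is invertible this makes `V₀` a
direct summand of `W`. -/
lemma permutationPush_pull {m : k} (hm : ∀ y, (Nat.card {x // π x = y} : k) = m) (v : V₀) :
    permutationPush b hb c hc π hπ (permutationPull b hb c hc π hπ v) = m • v := by
  classical
  suffices (permutationPush b hb c hc π hπ).toLinearMap ∘ₗ
      (permutationPull b hb c hc π hπ).toLinearMap = m • LinearMap.id from
    LinearMap.congr_fun this v
  refine c.ext fun y => ?_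
  simp only [LinearMap.comp_apply, IntertwiningMap.toLinearMap_apply, permutationPull_apply,
    map_sum, permutationPush_apply]
  rw [Finset.sum_congr rfl fun x hx => by rw [(Finset.mem_filter.1 hx).2], Finset.sum_const,
    ← hm y, Nat.card_eq_fintype_card, Fintype.card_subtype]
  simp [Nat.cast_smul_eq_nsmul]

include hb in
/-- The fixed vectors of a transitive permutation module are the multiples of the sum of
the basis. -/
lemma exists_eq_smul_sum_of_forall_apply_eq {D : Subgroup G} {x₀ : X}
    (htr : ∀ x, ∃ d ∈ D, d • x₀ = x) {w : W} (hw : ∀ d ∈ D, τ d w = w) :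
    ∃ a : k, w = a • ∑ x, b x := by
  refine ⟨b.repr w x₀, ?_⟩
  conv_lhs => rw [← b.sum_repr w]
  rw [Finset.smul_sum]
  refine Finset.sum_congr rfl fun x _ => ?_
  congr 1
  obtain ⟨d, hd, rfl⟩ := htr x
  have h2 : w = ∑ y, b.repr w (d⁻¹ • y) • b y := by
    conv_lhs => rw [← hw d hd, ← b.sum_repr w, map_sum]
    exact Fintype.sum_equiv (MulAction.toPerm d) _ _ fun y => by simp [hb]
  have h4 := congrArg (fun w => b.repr w (d • x₀)) h2
  simp only [Basis.repr_sum_self] at h4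
  rw [h4, inv_smul_smul]

include hb in
lemma apply_sum_basis (g : G) : τ g (∑ x, b x) = ∑ x, b x := by
  rw [map_sum]
  exact Fintype.sum_equiv (MulAction.toPerm g) _ _ fun x => by simp [hb]

lemma sum_basis_ne_zero (x₀ : X) : ∑ x, b x ≠ 0 := by
  classical
  intro h
  have := congrArg (fun w => b.repr w x₀) h
  simp [Finsupp.single_apply] at this

variable {p : ℕ} [Fact p.Prime] [CharP k p]

lemma span_basis_orbit_eq_top {D : Subgroup G} {y₀ : Y} (htr : ∀ y, ∃ d ∈ D, d • y₀ = y)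
    (hc : ∀ g y, ρ g (c y) = c (g • y)) :
    Submodule.span k (Set.range fun d : D => ρ d (c y₀)) = ⊤ := by
  rw [eq_top_iff, ← c.span_eq, Submodule.span_le]
  rintro _ ⟨y, rfl⟩
  obtain ⟨d, hd, rfl⟩ := htr y
  exact Submodule.subset_span ⟨⟨d, hd⟩, hc d y₀⟩

include hπ in
/-- An indecomposable summand of a transitive permutation module on `X` that has a non-zero fixed
vector is the permutation module on `Y`, if `X → Y` has fibres of invertible size and a
`p`-subgroup is transitive on `Y`. -/
lemma exists_basis_of_isIndecomposableRep [Finite G] [Fintype Y] {m : k} (hm0 : m ≠ 0)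
    (hm : ∀ y, (Nat.card {x // π x = y} : k) = m) (hb : ∀ g x, τ g (b x) = b (g • x))
    (hc : ∀ g y, ρ g (c y) = c (g • y)) {x₀ : X} (hX : ∀ x, ∃ g : G, g • x₀ = x)
    {D : Subgroup G} (hD : IsPGroup p D) {y₀ : Y} (hY : ∀ y, ∃ d ∈ D, d • y₀ = y)
    (hσ : IsIndecomposableRep σ) (i : σ.IntertwiningMap τ) (r : τ.IntertwiningMap σ)
    (hri : ∀ v, r (i v) = v) {v : V} (hv0 : v ≠ 0) (hv : ∀ g, σ g v = v) :
    ∃ b' : Basis Y k V, ∀ g y, σ g (b' y) = b' (g • y) := by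
  let P := permutationPush b hb c hc π hπ
  let J := permutationPull b hb c hc π hπ
  have hPJ : ∀ v, P (J v) = m • v := permutationPush_pull b hb c hc π hπ hm
  have hJ : J (∑ y, c y) = ∑ x, b x := permutationPull_sum b hb c hc π hπ
  -- Proving this endomorphism bijective makes `V₀` a summand of `σ`, and indecomposability of `σ`
  -- then gives an isomorphism.
  let f : ρ.IntertwiningMap ρ := ((P.comp i).comp r).comp J
  have hf : ∀ u, f u = P (i (r (J u))) := fun u => rfl
  -- By transitivity `i v` is a non-zero multiple of the sum of the basis of `W`, so that sum lies
  -- in the image of `i` and is fixed by `i ∘ r`.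
  have hfsum : f (∑ y, c y) = m • ∑ y, c y := by
    obtain ⟨a, ha⟩ := exists_eq_smul_sum_of_forall_apply_eq (D := ⊤) b hb (x₀ := x₀)
      (w := i v) (fun x => by simpa using hX x) (fun g _ => by rw [← i.isIntertwining, hv])
    have ha0 : a ≠ 0 := by
      rintro rfl
      apply hv0
      rw [← hri v, ha, zero_smul, map_zero]
    have h1 : ∑ x, b x = i (a⁻¹ • v) := by
      rw [map_smul, ha, inv_smul_smul₀ ha0]
    rw [hf, hJ, h1, hri, ← h1, ← hJ, hPJ]
  -- A non-zero kernel would contain a non-zero `D`-fixed vector, a multiple of `∑ y, c y`; but `f`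
  -- scales that sum by `m ≠ 0`.
  have hinj : LinearMap.ker f.toLinearMap = ⊥ := by
    by_contra hne
    have : Nontrivial f.ker.toSubmodule := Submodule.nontrivial_iff_ne_bot.2 hne
    obtain ⟨u, hu0, hu⟩ := hD.exists_ne_zero_forall_apply_eq
      ((f.ker.toRepresentation).comp D.subtype)
    obtain ⟨a, ha⟩ := exists_eq_smul_sum_of_forall_apply_eq c hc hY (w := (u : V₀))
      (fun d hd => congrArg Subtype.val (hu ⟨d, hd⟩))
    have hfu : f (u : V₀) = 0 := u.2
    rw [ha, map_smul, hfsum] at hfu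
    have := sum_basis_ne_zero c y₀
    simp only [smul_eq_zero, hm0, this, or_false] at hfu
    exact hu0 (Subtype.ext (by rw [ha, hfu, zero_smul]; rfl))
  have hfin : FiniteDimensional k V₀ := Module.Finite.of_basis c
  let F : V₀ ≃ₗ[k] V₀ := LinearEquiv.ofInjectiveEndo f.toLinearMap (LinearMap.ker_eq_bot.1 hinj)
  have hF : ∀ u, F u = P (i (r (J u))) := fun u => rfl
  let a : ρ.IntertwiningMap σ := r.comp J
  let q : σ.IntertwiningMap ρ := P.comp i
  have hqa : ∀ u, q (a u) = F u := fun u => rfl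
  have hcompl : IsCompl a.range q.ker := by
    refine IsCompl.of_eq ?_ ?_
    · refine eq_bot_iff.2 ?_
      rintro _ ⟨⟨u, rfl⟩, hu⟩
      have h1 : F u = 0 := (hqa u).symm.trans hu
      obtain rfl := F.map_eq_zero_iff.1 h1
      exact map_zero a
    · refine eq_top_iff.2 fun w _ => ?_
      refine (Submodule.mem_sup (p := a.range.toSubmodule) (p' := q.ker.toSubmodule)).2
        ⟨a (F.symm (q w)), ⟨_, rfl⟩, w - a (F.symm (q w)), ?_, by abel⟩
      change q (w - a (F.symm (q w))) = 0
      rw [map_sub, hqa, F.apply_symm_apply, sub_self]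
  have hainj : Function.Injective a := fun u w huw => by
    apply F.injective
    rw [← hqa, ← hqa, huw]
  have hasurj : Function.Surjective a := by
    rcases hσ.2 _ _ hcompl with h | h
    · exfalso
      have h1 : a (∑ y, c y) ∈ (⊥ : Subrepresentation σ) := h ▸ ⟨_, rfl⟩
      have h2 : a (∑ y, c y) = a 0 := by rw [map_zero]; exact h1
      exact sum_basis_ne_zero c y₀ (hainj h2)
    · intro w
      have h1 : w - a (F.symm (q w)) ∈ q.ker := by
        change q (w - a (F.symm (q w))) = 0
        rw [map_sub, hqa, F.apply_symm_apply, sub_self]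
      rw [h] at h1
      exact ⟨_, (sub_eq_zero.1 h1).symm⟩
  let A : V₀ ≃ₗ[k] V := LinearEquiv.ofBijective a.toLinearMap ⟨hainj, hasurj⟩
  refine ⟨c.map A, fun g y => ?_⟩
  rw [Basis.map_apply, Basis.map_apply, ← hc]
  have h1 : a (ρ g (c y)) = σ g (a (c y)) :=
    IntertwiningMap.isIntertwining ρ σ a g (c y)
  exact h1.symm

end TwoBases

lemma card_fiber_quotientMapOfLE {H K : Subgroup G} (h : H ≤ K) (y : G ⧸ K) :
    Nat.card {x // Subgroup.quotientMapOfLE h x = y} = H.relIndex K := by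
  have e : {x // Subgroup.quotientMapOfLE h x = y} ≃ K ⧸ H.subgroupOf K :=
    ((Subgroup.quotientEquivProdOfLE h).subtypeEquiv (q := fun z => z.1 = y)
      fun x => Iff.rfl).trans
      { toFun := fun z => z.1.2
        invFun := fun z => ⟨(y, z), rfl⟩
        left_inv := by rintro ⟨⟨_, z⟩, rfl⟩; rfl
        right_inv := fun _ => rfl }
  rw [Nat.card_congr e]
  rfl

lemma quotientMapOfLE_smul {H K : Subgroup G} (h : H ≤ K) (g : G) (x : G ⧸ H) :
    Subgroup.quotientMapOfLE h (g • x) = g • Subgroup.quotientMapOfLE h x := by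
  obtain ⟨a, rfl⟩ := QuotientGroup.mk_surjective x
  rfl

variable {p : ℕ} [Fact p.Prime] [CharP k p] [Finite G] {H K : Subgroup G}

/-- If `H ≤ K` has index prime to `p` and a `p`-subgroup is transitive on `G/K`, then the Scott
module of `H` is the permutation module on `G/K`. -/
lemma IsScottModule.exists_basis (hHK : H ≤ K) (hm : (H.relIndex K : k) ≠ 0)
    {D : Subgroup G} (hD : IsPGroup p D) (hY : ∀ y : G ⧸ K, ∃ d ∈ D, d • ((1 : G) : G ⧸ K) = y)
    {V : Type*} [AddCommGroup V] [Module k V] {σ : Representation k G V}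
    (hσ : IsScottModule H σ) :
    ∃ b : Basis (G ⧸ K) k V, ∀ g y, σ g (b y) = b (g • y) := by
  let _ := Fintype.ofFinite (G ⧸ H)
  let _ := Fintype.ofFinite (G ⧸ K)
  obtain ⟨b, hb⟩ := exists_basis_indTrivial (k := k) H
  obtain ⟨c, hc⟩ := exists_basis_ofMulAction (k := k) (G := G) (G ⧸ K)
  obtain ⟨hind, ⟨i, r, hri⟩, v, hv0, hv⟩ := hσ
  exact exists_basis_of_isIndecomposableRep b c (Subgroup.quotientMapOfLE hHK)
    (quotientMapOfLE_smul hHK) hm (fun y => by rw [card_fiber_quotientMapOfLE]) hb hc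
    (x₀ := ((1 : G) : G ⧸ H)) (fun x => MulAction.exists_smul_eq G _ x) hD hY hind i r hri hv0 hv

/-- The image of `k[G/K]` in `k[G/H]` under the fibre-sum map is the required summand: the index is
invertible, so it splits, and it is generated over `D` by one vector. -/
lemma exists_isScottModule (hHK : H ≤ K) (hm : (H.relIndex K : k) ≠ 0)
    {D : Subgroup G} (hD : IsPGroup p D)
    (hY : ∀ y : G ⧸ K, ∃ d ∈ D, d • ((1 : G) : G ⧸ K) = y) :
    ∃ S : Subrepresentation (indTrivial k H), IsScottModule H S.toRepresentation := by
  let _ := Fintype.ofFinite (G ⧸ H)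
  let _ := Fintype.ofFinite (G ⧸ K)
  obtain ⟨b, hb⟩ := exists_basis_indTrivial (k := k) H
  obtain ⟨c, hc⟩ := exists_basis_ofMulAction (k := k) (G := G) (G ⧸ K)
  have hπ := quotientMapOfLE_smul hHK
  let P := permutationPush b hb c hc _ hπ
  let J := permutationPull b hb c hc _ hπ
  have hPJ : ∀ v, P (J v) = (H.relIndex K : k) • v :=
    permutationPush_pull b hb c hc _ hπ fun y => by rw [card_fiber_quotientMapOfLE]
  have hJ : J (∑ y, c y) = ∑ x, b x := permutationPull_sum b hb c hc _ hπ
  have hsum := sum_basis_ne_zero b ((1 : G) : G ⧸ H)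
  let s : J.range.toSubmodule := ⟨∑ x, b x, ⟨_, hJ⟩⟩
  have hs : s ≠ 0 := fun h => hsum (congrArg Subtype.val h)
  refine ⟨J.range, ?_, ⟨⟨J.range.toSubmodule.subtype, fun g => rfl⟩, ?_, ?_⟩, s, hs, fun g =>
    Subtype.ext (apply_sum_basis b hb g)⟩
  · have : Nontrivial J.range.toSubmodule := ⟨s, 0, hs⟩
    refine isIndecomposableRep_of_span_eq_top _ D hD ⟨J (c ((1 : G) : G ⧸ K)), ⟨_, rfl⟩⟩ ?_
    have h1 := span_basis_orbit_eq_top c hY hc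
    have h2 := congrArg (Submodule.map J.toLinearMap.rangeRestrict) h1
    rw [Submodule.map_top, LinearMap.range_rangeRestrict, Submodule.map_span,
      ← Set.range_comp] at h2
    refine Eq.trans (congrArg (fun f => Submodule.span k (Set.range f)) ?_) h2
    funext d
    have h3 := IntertwiningMap.isIntertwining _ _ J (d : G) (c ((1 : G) : G ⧸ K))
    exact Subtype.ext h3.symm
  · exact
      { toLinearMap := (H.relIndex K : k)⁻¹ • J.toLinearMap.rangeRestrict ∘ₗ P.toLinearMap
        isIntertwining' := fun g => by
          refine LinearMap.ext fun w => Subtype.ext ?_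
          change (H.relIndex K : k)⁻¹ • J (P (indTrivial k H g w)) =
            indTrivial k H g ((H.relIndex K : k)⁻¹ • J (P w))
          rw [P.isIntertwining, J.isIntertwining, map_smul] }
  · rintro ⟨_, u, rfl⟩
    refine Subtype.ext ?_
    change (H.relIndex K : k)⁻¹ • J (P (J u)) = J u
    rw [hPJ, map_smul, inv_smul_smul₀ hm]

end ScottModule

/-! ### Transitivity of Sylow subgroups -/

section GroupActions

open MulAction

/-- For a Sylow `p`-subgroup `D` and the stabilizer `S`, the `p`-power `|C : S|` divides `|C : S ∩
D| = |D : S ∩ D|·|C : D|` and is prime to `|C : D|`. So the `D`-orbit is as large as the `C`-orbit.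
-/
lemma exists_isPGroup_forall_exists_smul_eq {p : ℕ} [Fact p.Prime] {C : Type*} [Group C] [Finite C]
    {X : Type*} [MulAction C X] (x : X) {a : ℕ} (hx : (stabilizer C x).index ∣ p ^ a) :
    ∃ D : Subgroup C, IsPGroup p D ∧ ∀ c : C, ∃ d ∈ D, d • x = c • x := by
  obtain ⟨D⟩ : Nonempty (Sylow p C) := inferInstance
  refine ⟨D, D.isPGroup', ?_⟩
  set S := stabilizer C x
  have hcop : S.index.Coprime (D : Subgroup C).index :=
    Nat.Coprime.of_dvd_left hx
      (((Fact.out : p.Prime).coprime_iff_not_dvd.2 D.not_dvd_index).pow_left a)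
  have h1 : S.index ∣ S.relIndex D := by
    have h2 : S.relIndex D * (D : Subgroup C).index = (S ⊓ D).index := by
      rw [← Subgroup.inf_relIndex_right, Subgroup.relIndex_mul_index inf_le_right]
    have h3 : S.index ∣ S.relIndex D * (D : Subgroup C).index := by
      rw [h2]
      exact Subgroup.index_dvd_of_le inf_le_left
    exact hcop.dvd_of_dvd_mul_right h3
  have h2 : stabilizer D x = S.subgroupOf D := by
    ext d
    simp [S, Subgroup.mem_subgroupOf, Subgroup.smul_def]
  have hsub : orbit D x ⊆ orbit C x := by
    rintro _ ⟨d, rfl⟩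
    exact ⟨d, rfl⟩
  have hfin : (orbit C x).Finite := Set.finite_range _
  have heq : orbit D x = orbit C x := by
    refine Set.eq_of_subset_of_ncard_le hsub ?_ hfin
    rw [← index_stabilizer, ← index_stabilizer, h2]
    refine Nat.le_of_dvd (Nat.pos_of_ne_zero ?_) h1
    exact Subgroup.index_ne_zero_of_finite
  intro c
  obtain ⟨d, hd⟩ := heq.ge ⟨c, rfl⟩
  exact ⟨d, d.2, hd⟩

end GroupActions

/-! ### Park's group as a wreath product -/

section ParkGroup

open MulAction

variable {M : Type*} [Group M] (P : Subgroup M)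

lemma ParkGroup.apply_mul (f : ParkGroup P) (m : M) {u : M} (hu : u ∈ P) :
    (f : Equiv.Perm M) (m * u) = (f : Equiv.Perm M) m * u :=
  f.2 m u hu

/-- This provides the action of Park's group on the cosets `M ⧸ P`. -/
instance : QuotientAction (ParkGroup P) P where
  inv_mul_mem f a c h := by
    have h1 := ParkGroup.apply_mul P f a h
    rw [mul_inv_cancel_left] at h1
    change ((f : Equiv.Perm M) a)⁻¹ * (f : Equiv.Perm M) c ∈ P
    rw [h1, inv_mul_cancel_left]
    exact h

/-- The embedding of `M` into Park's group by left multiplication. -/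
def parkLeft : M →* ParkGroup P where
  toFun s := ⟨Equiv.mulLeft s, fun m v _ => (mul_assoc s m v).symm⟩
  map_one' := by ext; simp
  map_mul' u v := by ext; simp

lemma parkLeft_apply (s m : M) : (parkLeft P s : Equiv.Perm M) m = s * m := rfl

lemma parkLeft_injective : Function.Injective (parkLeft P) := fun s t h => by
  have := congrArg (fun f : ParkGroup P => (f : Equiv.Perm M) 1) h
  simpa [parkLeft_apply] using this

lemma parkEmbedding_range : (parkEmbedding P).range = P.map (parkLeft P) := by
  ext f
  constructor
  · rintro ⟨u, rfl⟩
    exact ⟨u, u.2, rfl⟩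
  · rintro ⟨u, hu, rfl⟩
    exact ⟨⟨u, hu⟩, rfl⟩

lemma parkEmbedding_range_le : (parkEmbedding P).range ≤ (parkLeft P).range := by
  rw [parkEmbedding_range]
  exact Subgroup.map_le_range _ _

lemma parkEmbedding_relIndex : (parkEmbedding P).range.relIndex (parkLeft P).range = P.index := by
  rw [parkEmbedding_range, MonoidHom.range_eq_map,
    Subgroup.relIndex_map_map_of_injective _ _ (parkLeft_injective P), Subgroup.relIndex_top_right]

/-- Park's group is the wreath product of `P` with the symmetric group on the right cosets. -/
lemma nonempty_parkGroup_mulEquiv {ι : Type*} (e : M ⧸ P ≃ ι) :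
    Nonempty (ParkGroup P ≃* (ι → P) ⋊[mulAutArrow] Equiv.Perm ι) := by
  let c : M → ι := fun m => e (m : M ⧸ P)
  let t : ι → M := fun i => (e.symm i).out
  have hct : ∀ i, c (t i) = i := fun i => by simp [c, t]
  have hcu : ∀ m, ∀ u ∈ P, c (m * u) = c m := fun m u hu => by
    simp [c, QuotientGroup.mk_mul_of_mem m hu]
  have htc : ∀ m, (t (c m))⁻¹ * m ∈ P := fun m => by
    rw [← QuotientGroup.eq]; simp [c, t]
  -- With `t i` representing coset `i`, this sends `t i * u` to `t j * (w.left j * u)`, where `j =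
  -- w.right i`. The left component is read at the target `j` because `mulAutArrow` precomposes with
  -- the inverse permutation.
  let F : (ι → P) ⋊[mulAutArrow] Equiv.Perm ι → M → M := fun w m =>
    t (w.right (c m)) * (w.left (w.right (c m)) * ((t (c m))⁻¹ * m))
  have hF : ∀ w i, ∀ u ∈ P, F w (t i * u) = t (w.right i) * (w.left (w.right i) * u) := by
    intro w i u hu
    simp [F, hcu _ u hu, hct]
  have hm : ∀ m, ∃ i, ∃ u ∈ P, m = t i * u := fun m => ⟨c m, _, htc m, by simp⟩
  have hone : ∀ m, F 1 m = m := by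
    intro m
    obtain ⟨i, u, hu, rfl⟩ := hm m
    rw [hF 1 i u hu]
    simp
  have hmul : ∀ w₁ w₂ m, F (w₁ * w₂) m = F w₁ (F w₂ m) := by
    intro w₁ w₂ m
    obtain ⟨i, u, hu, rfl⟩ := hm m
    rw [hF _ i u hu, hF _ i u hu, hF _ _ _ (mul_mem (SetLike.coe_mem _) hu)]
    simp only [SemidirectProduct.mul_left, SemidirectProduct.mul_right, Equiv.Perm.mul_apply,
      Pi.mul_apply, Subgroup.coe_mul, mul_assoc]
    congr 3
    have h1 : mulAutArrow w₁.right w₂.left (w₁.right (w₂.right i)) =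
        w₂.left (w₁.right.symm (w₁.right (w₂.right i))) := rfl
    rw [h1, Equiv.symm_apply_apply]
  let E : (ι → P) ⋊[mulAutArrow] Equiv.Perm ι →* Equiv.Perm M :=
    { toFun := fun w => ⟨F w, F w⁻¹, fun m => by rw [← hmul, inv_mul_cancel, hone],
        fun m => by rw [← hmul, mul_inv_cancel, hone]⟩
      map_one' := Equiv.ext hone
      map_mul' := fun w₁ w₂ => Equiv.ext (hmul w₁ w₂) }
  have hE : ∀ w, E w ∈ ParkGroup P := by
    intro w m u hu
    change F w (m * u) = F w m * u
    obtain ⟨i, v, hv, rfl⟩ := hm m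
    rw [mul_assoc, hF _ _ _ (mul_mem hv hu), hF _ _ _ hv]
    simp [mul_assoc]
  have hcF : ∀ w i, c (F w (t i)) = w.right i := by
    intro w i
    have := hF w i 1 P.one_mem
    rw [mul_one, mul_one] at this
    rw [this, hcu _ _ (SetLike.coe_mem _), hct]
  refine ⟨(MulEquiv.ofBijective (E.codRestrict (ParkGroup P) hE) ⟨?_, ?_⟩).symm⟩
  · intro w₁ w₂ h
    have hFF : F w₁ = F w₂ := congrArg (fun f : ParkGroup P => ((f : Equiv.Perm M) : M → M)) h
    have hr : w₁.right = w₂.right := Equiv.ext fun i => by rw [← hcF, hFF, hcF]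
    refine SemidirectProduct.ext ?_ hr
    funext i
    have h1 := congrFun hFF (t (w₁.right⁻¹ i) * 1)
    rw [hF _ _ _ P.one_mem, hF _ _ _ P.one_mem, ← hr] at h1
    simpa using h1
  · intro f
    let r : Equiv.Perm ι := (e.symm.trans (MulAction.toPerm f)).trans e
    have hr : ∀ i, c ((f : Equiv.Perm M) (t i)) = r i := by
      intro i
      have h1 : e.symm i = (t i : M ⧸ P) := by simp [t]
      change e (f • (t i : M ⧸ P)) = e (f • e.symm i)
      rw [h1]
    let l : ι → P := fun j => ⟨_, htc ((f : Equiv.Perm M) (t (r.symm j)))⟩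
    refine ⟨⟨l, r⟩, Subtype.ext (Equiv.ext fun m => ?_)⟩
    change F ⟨l, r⟩ m = (f : Equiv.Perm M) m
    obtain ⟨i, u, hu, rfl⟩ := hm m
    rw [hF _ _ _ hu, ParkGroup.apply_mul P f _ hu]
    have h1 : (l (r i) : M) = (t (r i))⁻¹ * (f : Equiv.Perm M) (t i) := by
      simp only [l, Equiv.symm_apply_apply, hr]
    simp [h1, ← mul_assoc]

end ParkGroup

/-! ### Fusion and centralizers of `2`-subgroups in Park's group -/

section ParkFusion

open MulAction

variable {M : Type*} [Group M] {P : Subgroup M}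

/-- A bijection in Park's group which conjugates `r` to `s` on a coset `mP` fixed by `r` is
induced by an element of `M`. -/
lemma ParkGroup.mul_apply_mul_inv (g : ParkGroup P) {r s m : M} (hm : m⁻¹ * r * m ∈ P)
    (h : parkLeft P s * g = g * parkLeft P r) :
    s * ((g : Equiv.Perm M) m * m⁻¹) = (g : Equiv.Perm M) m * m⁻¹ * r := by
  have h1 := congrArg (fun f : ParkGroup P => (f : Equiv.Perm M) m) h
  have h2 : s * (g : Equiv.Perm M) m = (g : Equiv.Perm M) (r * m) := h1
  have h3 := ParkGroup.apply_mul P g m hm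
  have h4 : m * (m⁻¹ * r * m) = r * m := by group
  rw [h4, ← h2] at h3
  rw [← mul_assoc, h3]
  group

lemma IsPGroup.exists_forall_inv_mul_mul_mem {p : ℕ} [Fact p.Prime] {R : Subgroup M}
    (hR : IsPGroup p R) (hP : ¬ p ∣ P.index) : ∃ m : M, ∀ r ∈ R, m⁻¹ * r * m ∈ P := by
  obtain ⟨x, hx⟩ := hR.nonempty_fixed_point_of_prime_not_dvd_card (M ⧸ P) hP
  obtain ⟨m, rfl⟩ := QuotientGroup.mk_surjective x
  refine ⟨m, fun r hr => ?_⟩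
  have h1 : ((r * m : M) : M ⧸ P) = m := hx ⟨r, hr⟩
  rw [mul_assoc]
  exact QuotientGroup.eq.1 h1.symm

/-- Park's group induces on the `p`-subgroups of `M` only the fusion of `M`. -/
lemma exists_mem_centralizer_smul_eq {p : ℕ} [Fact p.Prime] (hP : ¬ p ∣ P.index)
    {Q : Subgroup (ParkGroup P)} (hQ : IsPGroup p Q) (hQM : Q ≤ (parkLeft P).range)
    {y : ParkGroup P ⧸ (parkLeft P).range} (hy : ∀ q ∈ Q, q • y = y) :
    ∃ c ∈ Subgroup.centralizer (Q : Set (ParkGroup P)),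
      c • ((1 : ParkGroup P) : ParkGroup P ⧸ (parkLeft P).range) = y := by
  obtain ⟨g, rfl⟩ := QuotientGroup.mk_surjective y
  let φ : M →* ParkGroup P := (MulAut.conj g).toMonoidHom.comp (parkLeft P)
  have hφ : Function.Injective φ := (MulAut.conj g).injective.comp (parkLeft_injective P)
  have hφ' : ∀ r, φ r = g * parkLeft P r * g⁻¹ := fun r => rfl
  obtain ⟨m, hm⟩ := (hQ.comap_of_injective φ hφ).exists_forall_inv_mul_mul_mem hP
  -- Both `g` and `z` conjugate each `r` in `Q.comap φ` to the same element of `Q`, so `g * parkLeft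
  -- P z⁻¹` centralizes `Q`; it lies in the coset of `g`.
  let z : M := (g : Equiv.Perm M) m * m⁻¹
  refine ⟨g * parkLeft P z⁻¹, Subgroup.mem_centralizer_iff.2 fun q hq => ?_, ?_⟩
  · obtain ⟨s, rfl⟩ := hQM hq
    have h1 : g⁻¹ * (parkLeft P s * g) ∈ (parkLeft P).range :=
      QuotientGroup.eq.1 (hy _ hq).symm
    obtain ⟨r, hr⟩ := h1
    have h2 : parkLeft P s * g = g * parkLeft P r := by rw [hr, mul_inv_cancel_left]
    have h3 : r ∈ Q.comap φ := by
      rw [Subgroup.mem_comap, hφ', ← h2, mul_inv_cancel_right]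
      exact hq
    have h4 : s * z = z * r := ParkGroup.mul_apply_mul_inv g (hm r h3) h2
    rw [← mul_assoc, h2, mul_assoc, mul_assoc, ← map_mul, ← map_mul]
    congr 2
    rw [eq_inv_mul_iff_mul_eq, ← mul_assoc, ← h4, mul_inv_cancel_right]
  · change ((g * parkLeft P z⁻¹ * 1 : ParkGroup P) : ParkGroup P ⧸ (parkLeft P).range) = g
    rw [mul_one]
    exact QuotientGroup.mk_mul_of_mem g ⟨_, rfl⟩

/-- If an element of order `3` of Park's group of a subgroup `P` of index `3` centralizes a
`2`-subgroup of `M`, then so does an element of order `3` of `M`. -/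
lemma three_dvd_card_centralizer [Finite M] (hP2 : IsPGroup 2 P) (hP : P.index = 3)
    {R : Subgroup M} (hR : IsPGroup 2 R) {f : ParkGroup P} (hf : orderOf f = 3)
    (hfR : ∀ r ∈ R, parkLeft P r * f = f * parkLeft P r) :
    3 ∣ Nat.card (Subgroup.centralizer (R : Set M)) := by
  have hf3 : f ^ 3 = 1 := hf ▸ pow_orderOf_eq_one f
  have hcard : Nat.card (M ⧸ P) = 3 := hP
  have : Fact (Nat.Prime 3) := ⟨Nat.prime_three⟩
  -- The number of cosets fixed by `f` is `0` or `3`. If it is `3`, then `f m = m * u` with `u ∈ P`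
  -- and `u ^ 3 = 1`, so `u = 1` as `P` is a `2`-group, and `f` would be trivial.
  have hnofix : ∀ x : M ⧸ P, f • x ≠ x := by
    intro x hx
    have hZ : IsPGroup 3 (Subgroup.zpowers f) :=
      IsPGroup.of_card (n := 1) (by rw [Nat.card_zpowers, hf, pow_one])
    have h1 := hZ.card_modEq_card_fixedPoints (M ⧸ P)
    have hmem : ∀ y : M ⧸ P, y ∈ fixedPoints (Subgroup.zpowers f) (M ⧸ P) ↔ f • y = y := by
      intro y
      refine ⟨fun h => h ⟨f, Subgroup.mem_zpowers f⟩, fun h g => ?_⟩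
      have h2 : Subgroup.zpowers f ≤ stabilizer (ParkGroup P) y := by
        rw [Subgroup.zpowers_le]; exact h
      exact h2 g.2
    have hpos : 0 < Nat.card (fixedPoints (Subgroup.zpowers f) (M ⧸ P)) :=
      Finite.card_pos_iff.2 ⟨⟨x, (hmem x).2 hx⟩⟩
    rw [hcard] at h1
    have h3 : 3 ≤ Nat.card (fixedPoints (Subgroup.zpowers f) (M ⧸ P)) := by
      refine Nat.le_of_dvd hpos ?_
      exact (Nat.modEq_zero_iff_dvd.1 (h1.symm.trans (by rfl)))
    have h4 : fixedPoints (Subgroup.zpowers f) (M ⧸ P) = Set.univ := by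
      refine Set.eq_of_subset_of_ncard_le (Set.subset_univ _) ?_
      rw [Set.ncard_univ, hcard]
      exact h3
    have hf1 : f = 1 := by
      refine Subtype.ext (Equiv.ext fun m => ?_)
      have h5 : f • (m : M ⧸ P) = m := (hmem _).1 (h4 ▸ Set.mem_univ _)
      have h6 : m⁻¹ * (f : Equiv.Perm M) m ∈ P := QuotientGroup.eq.1 h5.symm
      obtain ⟨u, hu, hfu⟩ : ∃ u ∈ P, (f : Equiv.Perm M) m = m * u := ⟨_, h6, by simp⟩
      have h7 : (f : Equiv.Perm M) ((f : Equiv.Perm M) ((f : Equiv.Perm M) m)) = m :=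
        congrArg (fun f : ParkGroup P => (f : Equiv.Perm M) m) hf3
      rw [hfu, ParkGroup.apply_mul P f _ hu, hfu, mul_assoc, ParkGroup.apply_mul P f _
        (mul_mem hu hu), hfu, mul_assoc, mul_eq_left] at h7
      have h8 : (⟨u, hu⟩ : P) ^ 3 = 1 := Subtype.ext (by simpa [pow_succ, mul_assoc] using h7)
      have h9 := (hP2.orderOf_coprime (n := 3) (by norm_num) ⟨u, hu⟩).eq_one_of_dvd
        (orderOf_dvd_of_pow_eq_one h8)
      have h10 : u = 1 := congrArg Subtype.val (orderOf_eq_one_iff.1 h9)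
      rw [hfu, h10, mul_one]
      rfl
    rw [hf1, orderOf_one] at hf
    norm_num at hf
  obtain ⟨m, hm⟩ := hR.exists_forall_inv_mul_mul_mem (P := P) (by rw [hP]; norm_num)
  -- On a coset fixed by `R`, an element centralizing `R` acts as some element of `C_M(R)`. Applied
  -- to `f` and `f * f`, this gives a `C_M(R)`-orbit of length `3`.
  have horb : ∀ g : ParkGroup P, (∀ r ∈ R, parkLeft P r * g = g * parkLeft P r) →
      g • (m : M ⧸ P) ∈ orbit (Subgroup.centralizer (R : Set M)) (m : M ⧸ P) := by
    intro g hg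
    refine ⟨⟨(g : Equiv.Perm M) m * m⁻¹, Subgroup.mem_centralizer_iff.2 fun r hr =>
      ParkGroup.mul_apply_mul_inv g (hm r hr) (hg r hr)⟩, ?_⟩
    change (((g : Equiv.Perm M) m * m⁻¹ * m : M) : M ⧸ P) = _
    rw [inv_mul_cancel_right]
    rfl
  have h1 := hnofix (m : M ⧸ P)
  have h2 := hnofix (f • (m : M ⧸ P))
  have h3 : f • f • (m : M ⧸ P) ≠ m := by
    intro h
    have h4 := congrArg (f • ·) h
    simp only [← mul_smul] at h4
    rw [← mul_assoc, ← pow_three', hf3, one_smul] at h4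
    exact h1 h4.symm
  have hsub : ({(m : M ⧸ P), f • (m : M ⧸ P), f • f • (m : M ⧸ P)} : Set (M ⧸ P)) ⊆
      orbit (Subgroup.centralizer (R : Set M)) (m : M ⧸ P) := by
    rintro _ (rfl | rfl | rfl)
    · exact mem_orbit_self _
    · exact horb f hfR
    · rw [← mul_smul]
      refine horb (f * f) fun r hr => ?_
      rw [← mul_assoc, hfR r hr, mul_assoc, hfR r hr, mul_assoc]
  have hle := Set.ncard_le_ncard hsub (Set.toFinite _)
  rw [Set.ncard_insert_of_notMem (by
      rintro (h | h)
      · exact h1 h.symm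
      · exact h3 h.symm), Set.ncard_pair h2.symm] at hle
  have hge : (orbit (Subgroup.centralizer (R : Set M)) (m : M ⧸ P)).ncard ≤ 3 := by
    rw [← hcard, ← Set.ncard_univ]
    exact Set.ncard_le_ncard (Set.subset_univ _)
  rw [← index_stabilizer] at hle hge
  rw [← le_antisymm hge hle]
  exact Subgroup.index_dvd_card _

variable [Finite M] {N : ℕ}

/-- The case where `Q` fixes the base coset. A factor `3` of `|C_G(Q)|` also divides the order of
the stabilizer, so the orbit length is a power of `2`. -/
lemma exists_isPGroup_transitive_fixedPoints_of_le (hP2 : IsPGroup 2 P) (hP : P.index = 3)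
    (hcard : Nat.card (ParkGroup P) = 3 * 2 ^ N)
    {Q : Subgroup (ParkGroup P)} (hQ : IsPGroup 2 Q) (hQM : Q ≤ (parkLeft P).range) :
    ∃ D ≤ Subgroup.centralizer (Q : Set (ParkGroup P)), IsPGroup 2 D ∧
      ∀ y : ParkGroup P ⧸ (parkLeft P).range, (∀ q ∈ Q, q • y = y) →
        ∃ d ∈ D, d • ((1 : ParkGroup P) : ParkGroup P ⧸ (parkLeft P).range) = y := by
  set C := Subgroup.centralizer (Q : Set (ParkGroup P)) with hC
  set o := ((1 : ParkGroup P) : ParkGroup P ⧸ (parkLeft P).range) with ho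
  have : Fact (Nat.Prime 3) := ⟨Nat.prime_three⟩
  have hCdvd : Nat.card C ∣ 3 * 2 ^ N := hcard ▸ Subgroup.card_subgroup_dvd_card C
  have hidx := (stabilizer C o).card_mul_index
  have hdvd : (stabilizer C o).index ∣ 2 ^ N := by
    by_cases h3 : 3 ∣ Nat.card C
    · obtain ⟨f, hf⟩ := exists_prime_orderOf_dvd_card' 3 h3
      let R : Subgroup M := Q.comap (parkLeft P)
      have hR : IsPGroup 2 R := hQ.comap_of_injective _ (parkLeft_injective P)
      have h4 := three_dvd_card_centralizer hP2 hP hR (f := f)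
        (by rw [Subgroup.orderOf_coe, hf])
        fun r hr => Subgroup.mem_centralizer_iff.1 f.2 _ hr
      obtain ⟨z, hz⟩ := exists_prime_orderOf_dvd_card' 3 h4
      have hzC : parkLeft P z ∈ C := by
        refine Subgroup.mem_centralizer_iff.2 fun q hq => ?_
        obtain ⟨s, rfl⟩ := hQM hq
        rw [← map_mul, ← map_mul, Subgroup.mem_centralizer_iff.1 z.2 s hq]
      have hzo : (⟨_, hzC⟩ : C) ∈ stabilizer C o := by
        change ((parkLeft P z * 1 : ParkGroup P) : ParkGroup P ⧸ (parkLeft P).range) = _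
        rw [mul_one, ho]
        exact QuotientGroup.eq.2 ⟨(z : M)⁻¹, by simp⟩
      have h5 : 3 ∣ Nat.card (stabilizer C o) := by
        have h6 : orderOf (⟨_, hzo⟩ : stabilizer C o) = 3 := by
          rw [← Subgroup.orderOf_coe, ← Subgroup.orderOf_coe,
            orderOf_injective _ (parkLeft_injective P), Subgroup.orderOf_coe, hz]
        rw [← h6]
        exact orderOf_dvd_natCard _
      have h7 : 3 * (stabilizer C o).index ∣ 3 * 2 ^ N :=
        (mul_dvd_mul_right h5 _).trans (hidx ▸ hCdvd)
      exact Nat.dvd_of_mul_dvd_mul_left (by norm_num) h7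
    · have h4 : (Nat.card C).Coprime 3 :=
        ((Nat.prime_three.coprime_iff_not_dvd).2 h3).symm
      exact (Subgroup.index_dvd_card _).trans (h4.dvd_of_dvd_mul_left hCdvd)
  obtain ⟨D, hD, htr⟩ := exists_isPGroup_forall_exists_smul_eq o hdvd
  refine ⟨D.map C.subtype, Subgroup.map_subtype_le D, hD.map _, fun y hy => ?_⟩
  obtain ⟨c, hc, rfl⟩ := exists_mem_centralizer_smul_eq (by rw [hP]; norm_num) hQ hQM hy
  obtain ⟨d, hd, hdc⟩ := htr ⟨c, hc⟩
  exact ⟨d, ⟨d, hd, rfl⟩, hdc⟩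

/-- The centralizer of a `2`-subgroup `Q` of Park's group contains a `2`-subgroup which is
transitive on the fixed points of `Q` in the cosets of `M`. -/
lemma exists_isPGroup_transitive_fixedPoints (hP2 : IsPGroup 2 P) (hP : P.index = 3)
    (hcard : Nat.card (ParkGroup P) = 3 * 2 ^ N)
    {Q : Subgroup (ParkGroup P)} (hQ : IsPGroup 2 Q)
    {x : ParkGroup P ⧸ (parkLeft P).range} (hx : ∀ q ∈ Q, q • x = x) :
    ∃ D ≤ Subgroup.centralizer (Q : Set (ParkGroup P)), IsPGroup 2 D ∧
      ∀ y : ParkGroup P ⧸ (parkLeft P).range, (∀ q ∈ Q, q • y = y) → ∃ d ∈ D, d • x = y := by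
  obtain ⟨g, rfl⟩ := QuotientGroup.mk_surjective x
  -- Conjugation by `g` moves the fixed point to the base coset.
  let γ : ParkGroup P →* ParkGroup P := (MulAut.conj g).toMonoidHom
  have hγ : ∀ a, γ a = g * a * g⁻¹ := fun a => rfl
  have hγi : Function.Injective γ := (MulAut.conj g).injective
  have hQM : Q.comap γ ≤ (parkLeft P).range := by
    intro q hq
    have h1 : ((g * q * g⁻¹ * g : ParkGroup P) : ParkGroup P ⧸ (parkLeft P).range) = g :=
      hx _ hq
    rw [inv_mul_cancel_right] at h1
    simpa using QuotientGroup.eq.1 h1.symm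
  obtain ⟨D, hDC, hD, htr⟩ := exists_isPGroup_transitive_fixedPoints_of_le hP2 hP hcard
    (hQ.comap_of_injective γ hγi) hQM
  refine ⟨D.map γ, ?_, hD.map γ, fun y hy => ?_⟩
  · rintro _ ⟨d, hd, rfl⟩
    refine Subgroup.mem_centralizer_iff.2 fun q hq => ?_
    have h1 : γ (g⁻¹ * q * g) = q := by rw [hγ]; group
    have h2 := Subgroup.mem_centralizer_iff.1 (hDC hd) (g⁻¹ * q * g)
      (by change γ _ ∈ Q; rwa [h1])
    rw [← h1, ← map_mul, ← map_mul, h2]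
  · obtain ⟨d, hd, hdy⟩ := htr (g⁻¹ • y) fun q hq => by
      have h1 : q * g⁻¹ = g⁻¹ * γ q := by rw [hγ]; group
      rw [← mul_smul, h1, mul_smul, hy _ hq]
    refine ⟨γ d, ⟨d, hd, rfl⟩, ?_⟩
    have h1 : (g : ParkGroup P ⧸ (parkLeft P).range) =
        g • ((1 : ParkGroup P) : ParkGroup P ⧸ (parkLeft P).range) := by
      change _ = ((g * 1 : ParkGroup P) : ParkGroup P ⧸ (parkLeft P).range)
      rw [mul_one]
    rw [h1, ← mul_smul, hγ, inv_mul_cancel_right, mul_smul, hdy, smul_inv_smul]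

end ParkFusion

/-! ### The main theorem -/

theorem theorem1p3 {k : Type*} [Field k] [IsAlgClosed k] [CharP k 2]
    {M : Type*} [Group M] [Finite M] (n : ℕ) (hn : 3 ≤ n)
    (hcard : Nat.card M = 3 * 2 ^ n) (hlen : HasPLength 2 M 2) (hcore : pPrimeCore 2 M = ⊥)
    (P : Sylow 2 M) :
    -- Park's group is isomorphic to the wreath product `P ≀ S_3`
    Nonempty (ParkGroup (P : Subgroup M) ≃*
      (Fin 3 → P) ⋊[mulAutArrow] Equiv.Perm (Fin 3)) ∧
    -- the Scott module `Sc(G, ιP)` exists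
    (∃ S : Subrepresentation (indTrivial k (parkEmbedding (P : Subgroup M)).range),
      IsScottModule (parkEmbedding (P : Subgroup M)).range S.toRepresentation) ∧
    -- and it is Brauer indecomposable
    ∀ (V : Type*) [AddCommGroup V] [Module k V]
      (σ : Representation k (ParkGroup (P : Subgroup M)) V),
      IsScottModule (parkEmbedding (P : Subgroup M)).range σ → IsBrauerIndecomposable 2 σ := by
  have hPcard : Nat.card P = 2 ^ n := by
    rw [P.card_eq_multiplicity, hcard,
      Nat.factorization_mul (by norm_num) (by positivity), Finsupp.add_apply,
      Nat.Prime.factorization_pow Nat.prime_two, Finsupp.single_eq_same,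
      Nat.factorization_eq_zero_of_not_dvd (by norm_num), zero_add]
  have hP : (P : Subgroup M).index = 3 := by
    have h1 := (P : Subgroup M).card_mul_index
    rw [hcard, hPcard, mul_comm] at h1
    exact Nat.eq_of_mul_eq_mul_right (by positivity) h1
  obtain ⟨e⟩ : Nonempty (M ⧸ (P : Subgroup M) ≃ Fin 3) := ⟨Finite.equivFinOfCardEq hP⟩
  obtain ⟨E⟩ := nonempty_parkGroup_mulEquiv (P : Subgroup M) e
  have hG : Nat.card (ParkGroup (P : Subgroup M)) = 3 * 2 ^ (3 * n + 1) := by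
    rw [Nat.card_congr E.toEquiv, SemidirectProduct.card, Nat.card_perm, Nat.card_fun, hPcard]
    simp only [Nat.card_fin, ← pow_mul, pow_succ, Nat.factorial]
    ring
  have htrans {Q : Subgroup (ParkGroup (P : Subgroup M))} (hQ : IsPGroup 2 Q) {x} :=
    exists_isPGroup_transitive_fixedPoints P.isPGroup' hP hG (Q := Q) hQ (x := x)
  have hm : ((parkEmbedding (P : Subgroup M)).range.relIndex
      (parkLeft (P : Subgroup M)).range : k) ≠ 0 := by
    rw [parkEmbedding_relIndex, hP]
    intro h
    have := (CharP.cast_eq_zero_iff k 2 3).1 h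
    norm_num at this
  -- For `Q = ⊥` every coset is fixed, so this is a `2`-subgroup transitive on all of `G/M`.
  obtain ⟨D, -, hD, hY⟩ := htrans (Q := ⊥) IsPGroup.of_bot
    (x := ((1 : ParkGroup (P : Subgroup M)) : _ ⧸ (parkLeft (P : Subgroup M)).range))
    fun q hq => by rw [Subgroup.mem_bot.1 hq, one_smul]
  have hY' : ∀ y, ∃ d ∈ D, d • _ = y := fun y => hY y fun q hq => by
    rw [Subgroup.mem_bot.1 hq, one_smul]
  refine ⟨⟨E⟩, exists_isScottModule (parkEmbedding_range_le _) hm hD hY',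
    fun V _ _ σ hσ Q hQ => ?_⟩
  obtain ⟨b, hb⟩ := hσ.exists_basis (parkEmbedding_range_le _) hm hD hY'
  exact subsingleton_or_isIndecomposableRep_brauerRep b hb Q fun x hx => htrans hQ hx
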